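/- **Theorem.** The discrete-time symmetric simple exclusion process (SSEP) with firing parameter $p$ is the following Markov process $(\eta_t)_{t\ge t_0}$ on $X=\{0,1\}^{\mathbb Z}$, where $t_0\in\mathbb Z$ is the initial time. Attach to the horizontal edge $e$ between $(x,t)$ and $(x+1,t)$, for all $(x,t)\in\mathbb Z^2$, a $\mathrm{Bernoulli}(p)$ firing variable $\xi(e)$ and a $\mathrm{Uniform}[0,1]$ variable $U(e)$, all of them independent of each other and of the initial configuration. An edge *stirs* if it fires ($\xi(e)=1$) and has the smallest $U$ in the maximal run of adjacent firing edges at its time level that contains it. A stirring particle starts at every site $x$ at time $t_0$; write $Z_x(t)$ for its position at time $t$, so $Z_x(t_0)=x$. For $t\ge t_0$ put $Z_x(t+1)=Z_x(t)+1$ if the edge between $(Z_x(t),t)$ and $(Z_x(t)+1,t)$ stirs, $Z_x(t+1)=Z_x(t)-1$ if the edge between $(Z_x(t)-1,t)$ and $(Z_x(t),t)$ stirs, and $Z_x(t+1)=Z_x(t)$ otherwise. Given $\eta_{t_0}$, let $\eta_t(x)=1$ if there is $y$ with $\eta_{t_0}(y)=1$ and $Z_y(t)=x$, and $\eta_t(x)=0$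 otherwise. Let $\mathbb P^{\nu}$ be the law of $(\eta_t)_{t\ge t_0}$ on $X^{\{t_0,t_0+1,\dots\}}$ when $\eta_{t_0}$ has law $\nu$. A probability measure $\nu$ on $X$ is *invariant* if, under $\mathbb P^\nu$, $\eta_t$ has law $\nu$ for every $t\ge t_0$. Let $0<p<1/2$ and $q\in[0,1]$, and let $\nu_q$ be the iid $\mathrm{Bernoulli}(q)$ product measure on $\{0,1\}^{\mathbb Z}$. Then $\nu_q$ is an ergodic invariant measure for the SSEP with firing parameter $p$. That is, $\nu_q$ is invariant; it is an extreme point of the convex set of invariant probability measures; and $\mathbb P^{\nu_q}$ is invariant and ergodic under the time shift $(\eta_t)_{t\ge t_0}\mapsto(\eta_{t+1})_{t\ge t_0}$. -/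

import Mathlib

open MeasureTheory ProbabilityTheory

namespace SSEP

/-- Particle configurations `{0,1}^ℤ`, with `true` for an occupied site. The σ-algebra is the
product one. -/
abbrev Config : Type := ℤ → Bool

/-- A realization of the stirring variables. The index `(x, t)` stands for the horizontal edge
between `(x, t)` and `(x + 1, t)`; its value is the pair (firing variable, tie-breaking variable). -/
abbrev Stirring : Type := ℤ × ℤ → Bool × unitInterval

/-- The law of the stirring variables: over all edges the pairs are independent, and each pair
consists of independent `Bernoulli(p)` and `Uniform[0,1]` variables. -/
noncomputable def stirringLaw (p : unitInterval) : Measure Stirring :=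
  Measure.infinitePi fun _ : ℤ × ℤ =>
    (bernoulliMeasure true false p).prod (volume : Measure unitInterval)

/-- The iid `Bernoulli(q)` measure on configurations. -/
noncomputable def bernoulliProduct (q : unitInterval) : Measure Config :=
  Measure.infinitePi fun _ : ℤ => bernoulliMeasure true false q

/-- The edge `(x, t)` stirs: it fires, and its tie-breaking variable is the smallest one in the
maximal run of adjacent firing edges at time `t` that contains it. The edge `(y, t)` is in that run
iff all edges from `x` to `y` fire. -/
def Stirs (S : Stirring) (x t : ℤ) : Prop :=
  (S (x, t)).1 = true ∧
    ∀ y : ℤ, y ≠ x → (∀ z ∈ Set.uIcc x y, (S (z, t)).1 = true) → (S (x, t)).2 < (S (y, t)).2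

open Classical in
/-- `position S t₀ x n` is the location at time `t₀ + n` of the stirring particle which is at `x`
at time `t₀`. -/
noncomputable def position (S : Stirring) (t₀ x : ℤ) : ℕ → ℤ
  | 0 => x
  | n + 1 =>
    if Stirs S (position S t₀ x n) (t₀ + n) then position S t₀ x n + 1
    else if Stirs S (position S t₀ x n - 1) (t₀ + n) then position S t₀ x n - 1
    else position S t₀ x n

open Classical in
/-- The trajectory `n ↦ η_{t₀ + n}` of the exclusion process: a site is occupied at time `t₀ + n`
iff the stirring particle there started from a site which is occupied in `η₀`. -/
noncomputable def trajectory (S : Stirring) (t₀ : ℤ) (η₀ : Config) (n : ℕ) : Config :=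
  fun x => decide (∃ y : ℤ, η₀ y = true ∧ position S t₀ y n = x)

/-- The law `ℙ^ν` on `Config^{t₀, t₀+1, …}` of the exclusion process with firing parameter `p`
started at time `t₀` from a random configuration with law `ν`, independent of the stirring
variables. The `n`-th coordinate is the configuration at time `t₀ + n`. -/
noncomputable def pathLaw (p : unitInterval) (t₀ : ℤ) (ν : Measure Config) :
    Measure (ℕ → Config) :=
  (ν.prod (stirringLaw p)).map fun ω => trajectory ω.2 t₀ ω.1

/-- `ν` is invariant: when the process starts from `ν`, every `η_{t₀ + n}` has law `ν`. -/
def IsInvariant (p : unitInterval) (t₀ : ℤ) (ν : Measure Config) : Prop :=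
  ∀ n : ℕ, (pathLaw p t₀ ν).map (fun η => η n) = ν

/-- The time shift on paths. -/
def timeShift (η : ℕ → Config) : ℕ → Config := fun n => η (n + 1)

theorem measurableSet_stirs (x t : ℤ) : MeasurableSet {S : Stirring | Stirs S x t} := by
  have hfire : ∀ z : ℤ, MeasurableSet {S : Stirring | (S (z, t)).1 = true} := fun z =>
    (measurable_fst.comp (measurable_pi_apply (z, t))) (measurableSet_singleton true)
  have hlt : ∀ y : ℤ, MeasurableSet {S : Stirring | (S (x, t)).2 < (S (y, t)).2} := fun y =>
    measurableSet_lt (measurable_snd.comp (measurable_pi_apply (x, t)))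
      (measurable_snd.comp (measurable_pi_apply (y, t)))
  have h : {S : Stirring | Stirs S x t} = {S | (S (x, t)).1 = true} ∩
      ⋂ y : ℤ, ⋂ _ : y ≠ x, (⋂ z ∈ Set.uIcc x y, {S | (S (z, t)).1 = true})ᶜ ∪
        {S | (S (x, t)).2 < (S (y, t)).2} := by
    ext S
    simp [Stirs, imp_iff_not_or]
  rw [h]
  refine (hfire x).inter (MeasurableSet.iInter fun y => MeasurableSet.iInter fun _ => ?_)
  refine MeasurableSet.union (MeasurableSet.compl ?_) (hlt y)
  exact MeasurableSet.iInter fun z => MeasurableSet.iInter fun _ => hfire z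

theorem measurable_position (t₀ x : ℤ) (n : ℕ) :
    Measurable fun S : Stirring => position S t₀ x n := by
  classical
  induction n with
  | zero => exact measurable_const
  | succ n ih =>
    have key : ∀ k : ℤ, MeasurableSet {S : Stirring | Stirs S (position S t₀ x n + k) (t₀ + n)} := by
      intro k
      have : {S : Stirring | Stirs S (position S t₀ x n + k) (t₀ + n)} =
          ⋃ m : ℤ, {S | position S t₀ x n = m} ∩ {S | Stirs S (m + k) (t₀ + n)} := by
        ext S; simp
      rw [this]
      exact MeasurableSet.iUnion fun m =>
        (ih (measurableSet_singleton m)).inter (measurableSet_stirs _ _)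
    have h0 := key 0
    have h1 := key (-1)
    simp only [add_zero] at h0
    simp only [← sub_eq_add_neg] at h1
    exact Measurable.ite h0 (ih.add_const 1) (Measurable.ite h1 (ih.sub_const 1) ih)

/-- The trajectory is a measurable function of the initial configuration and the stirring
variables, so that `pathLaw` is the push-forward of a measure under a measurable map. -/
theorem measurable_trajectory (t₀ : ℤ) :
    Measurable fun ω : Config × Stirring => trajectory ω.2 t₀ ω.1 := by
  classical
  refine measurable_pi_lambda _ fun n => measurable_pi_lambda _ fun x => ?_
  refine measurable_to_bool ?_
  have : (fun ω : Config × Stirring => trajectory ω.2 t₀ ω.1 n x) ⁻¹' {true} =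
      ⋃ y : ℤ, {ω | ω.1 y = true} ∩ {ω | position ω.2 t₀ y n = x} := by
    ext ω; simp [trajectory]
  rw [this]
  refine MeasurableSet.iUnion fun y => MeasurableSet.inter ?_ ?_
  · have hy : Measurable fun ω : Config × Stirring => ω.1 y :=
      (measurable_pi_apply y).comp measurable_fst
    exact hy (measurableSet_singleton true)
  · exact ((measurable_position t₀ y n).comp measurable_snd) (measurableSet_singleton x)

end SSEP

/-!
Let `P` be the law of the stirring variables and `ν` the product measure. For each realization of
the stirring variables the configuration is moved by a permutation of `ℤ`, so `ν` is preserved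
realization by realization; this gives invariance (`isInvariant_bernoulliProduct`). It also makes
the skew product `evolve`, which runs one step of the process and translates the stirring variables
in time, a measure preserving transformation for `P × ν`. The path process is a factor of it
(`semiconj_trajectory`).

The core is that `evolve` is mixing (`isMixing_evolve`). It suffices to consider rectangles of
cylinder events. Given the stirring variables, the initial configuration on a finite set `F` and the
configuration on a finite set `G` after `n` steps are independent, unless one of the stirring
particles that start in `F` is in `G` after `n` steps
(`bernoulliProduct_real_inter_trajectory`). A single stirring particle performs a lazy simple random
walk, whose jump probability `r` in each direction satisfies `0 < r ≤ p < 1 / 2`. By its Fourier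
representation, the probability to be at a given site tends to zero
(`tendsto_stirringLaw_real_position`).

Mixing passes to ergodicity of `evolve`, hence of the time shift on the factor. It also shows that,
when `evolve` starts from a law that is absolutely continuous with respect to `P × ν`, its law
converges setwise to `P × ν` (`IsMixing.tendsto_measureReal_preimage`). Hence an invariant
probability measure that is absolutely continuous with respect to `ν` equals `ν`, and `ν` is
extreme, since the components of a convex combination are absolutely continuous with respect to it.
-/

namespace SSEP

open Filter Topology

/-! ### Mixing transformations -/

section Mixing

variable {α : Type*} [m : MeasurableSpace α]

/-- Setwise convergence of finite measures that are dominated by one finite measure only has to be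
checked on a generating π-system and on the whole space. -/
theorem tendsto_measureReal_of_isPiSystem {μ ν : Measure α} [IsFiniteMeasure μ] [IsFiniteMeasure ν]
    {νs : ℕ → Measure α} (hle : ∀ n, νs n ≤ μ) {C : Set (Set α)}
    (hgen : m = MeasurableSpace.generateFrom C) (hpi : IsPiSystem C)
    (huniv : Tendsto (fun n => (νs n).real Set.univ) atTop (𝓝 (ν.real Set.univ)))
    (hC : ∀ A ∈ C, Tendsto (fun n => (νs n).real A) atTop (𝓝 (ν.real A)))
    {A : Set α} (hA : MeasurableSet A) :
    Tendsto (fun n => (νs n).real A) atTop (𝓝 (ν.real A)) := by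
  have hfin : ∀ n, IsFiniteMeasure (νs n) := fun n => isFiniteMeasure_of_le μ (hle n)
  induction A, hA using MeasurableSpace.induction_on_inter hgen hpi with
  | empty => simp
  | basic A hA => exact hC A hA
  | compl A hA ih =>
    simp only [measureReal_compl hA]
    exact huniv.sub ih
  | iUnion f hd hf ih =>
    have hsum : ∀ (ρ : Measure α) [IsFiniteMeasure ρ],
        HasSum (fun k => ρ.real (f k)) (ρ.real (⋃ k, f k)) := fun ρ _ => by
      have h := measure_iUnion (μ := ρ) hd hf
      have hne : ∑' k, ρ (f k) ≠ ⊤ := h ▸ measure_ne_top _ _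
      rw [measureReal_def, h, ENNReal.tsum_toReal_eq fun k => measure_ne_top _ _]
      exact ENNReal.hasSum_toReal hne
    rw [← (hsum ν).tsum_eq]
    simp_rw [← fun n => (hsum (νs n)).tsum_eq]
    refine tendsto_tsum_of_dominated_convergence (hsum μ).summable ih
      (Eventually.of_forall fun n k => ?_)
    rw [Real.norm_of_nonneg measureReal_nonneg]
    exact ENNReal.toReal_mono (measure_ne_top _ _) (hle n _)

/-- The transformation `T` is (strongly) mixing for `μ`: events in the distant future are
asymptotically independent of any given event. -/
def IsMixing (T : α → α) (μ : Measure α) : Prop :=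
  ∀ A B : Set α, MeasurableSet A → MeasurableSet B →
    Tendsto (fun n => μ.real (A ∩ T^[n] ⁻¹' B)) atTop (𝓝 (μ.real A * μ.real B))

variable {T : α → α} {μ : Measure α} [IsProbabilityMeasure μ]

theorem isMixing_of_isPiSystem (hT : MeasurePreserving T μ μ) {C : Set (Set α)}
    (hgen : m = MeasurableSpace.generateFrom C) (hpi : IsPiSystem C)
    (hC : ∀ A ∈ C, ∀ B ∈ C,
      Tendsto (fun n => μ.real (A ∩ T^[n] ⁻¹' B)) atTop (𝓝 (μ.real A * μ.real B))) :
    IsMixing T μ := by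
  have hCm : ∀ B ∈ C, MeasurableSet B := fun B hB => by
    rw [hgen]; exact MeasurableSpace.measurableSet_generateFrom hB
  -- Extend to all `A` for a fixed `B` of the π-system.
  have h1 : ∀ B ∈ C, ∀ A, MeasurableSet A →
      Tendsto (fun n => μ.real (A ∩ T^[n] ⁻¹' B)) atTop (𝓝 (μ.real A * μ.real B)) := by
    intro B hB A hA
    have hr : ∀ n A, MeasurableSet A →
        (μ.restrict (T^[n] ⁻¹' B)).real A = μ.real (A ∩ T^[n] ⁻¹' B) := fun n A hA => by
      rw [measureReal_restrict_apply hA]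
    have hs : ∀ A, ((μ B) • μ).real A = μ.real A * μ.real B := fun A => by
      rw [measureReal_ennreal_smul_apply, mul_comm]; rfl
    have : IsFiniteMeasure ((μ B) • μ) := ⟨by simp [measure_lt_top]⟩
    have key := tendsto_measureReal_of_isPiSystem (μ := μ) (ν := (μ B) • μ)
      (νs := fun n => μ.restrict (T^[n] ⁻¹' B)) (fun n => Measure.restrict_le_self) hgen hpi
      ?_ (fun A hA => ?_) hA
    · simpa only [hr _ _ hA, hs] using key
    · simp only [hr _ _ MeasurableSet.univ, hs, Set.univ_inter, probReal_univ, one_mul]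
      simp only [fun n => (hT.iterate n).measureReal_preimage (hCm B hB).nullMeasurableSet]
      exact tendsto_const_nhds
    · simpa only [hr _ _ (hCm A hA), hs] using hC A hA B hB
  -- Then extend to all `B` for a fixed measurable `A`.
  intro A B hA hB
  have hr : ∀ n B, MeasurableSet B →
      ((μ.restrict A).map T^[n]).real B = μ.real (A ∩ T^[n] ⁻¹' B) := fun n B hB => by
    rw [map_measureReal_apply (hT.iterate n).measurable hB,
      measureReal_restrict_apply ((hT.iterate n).measurable hB), Set.inter_comm]
  have hs : ∀ B, ((μ A) • μ).real B = μ.real A * μ.real B := fun B => by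
    rw [measureReal_ennreal_smul_apply]; rfl
  have : IsFiniteMeasure ((μ A) • μ) := ⟨by simp [measure_lt_top]⟩
  have key := tendsto_measureReal_of_isPiSystem (μ := μ) (ν := (μ A) • μ)
    (νs := fun n => (μ.restrict A).map T^[n]) (fun n => ?_) hgen hpi ?_ (fun B hB => ?_) hB
  · simpa only [hr _ _ hB, hs] using key
  · calc (μ.restrict A).map T^[n] ≤ μ.map T^[n] :=
        Measure.map_mono Measure.restrict_le_self (hT.iterate n).measurable
      _ = μ := (hT.iterate n).map_eq
  · simp only [hr _ _ MeasurableSet.univ, hs, Set.preimage_univ, Set.inter_univ, probReal_univ,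
      mul_one]
    exact tendsto_const_nhds
  · simpa only [hr _ _ (hCm B hB), hs] using h1 B hB A hA

theorem IsMixing.ergodic (h : IsMixing T μ) (hT : MeasurePreserving T μ μ) : Ergodic T μ where
  toMeasurePreserving := hT
  aeconst_set A hA hinv := by
    have hit : ∀ n, T^[n] ⁻¹' A = A := fun n => Function.IsFixedPt.preimage_iterate hinv n
    have h1 := h A A hA hA
    simp only [hit, Set.inter_self] at h1
    have h2 : μ.real A * μ.real A = μ.real A := tendsto_nhds_unique h1 tendsto_const_nhds
    rw [eventuallyConst_set']
    rcases IsIdempotentElem.iff_eq_zero_or_one.1 h2 with h3 | h3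
    · left
      rw [measureReal_eq_zero_iff] at h3
      exact ae_eq_empty.2 h3
    · right
      rw [ae_eq_univ, ← measureReal_eq_zero_iff, probReal_compl_eq_one_sub hA, h3, sub_self]

/-- Under a mixing transformation, an integrable density is forgotten in the long run. -/
theorem IsMixing.tendsto_setIntegral (h : IsMixing T μ) (hT : MeasurePreserving T μ μ)
    {B : Set α} (hB : MeasurableSet B) {f : α → ℝ} (hf : Integrable f μ) :
    Tendsto (fun n => ∫ x in T^[n] ⁻¹' B, f x ∂μ) atTop (𝓝 ((∫ x, f x ∂μ) * μ.real B)) := by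
  have hBn : ∀ n, MeasurableSet (T^[n] ⁻¹' B) := fun n => (hT.iterate n).measurable hB
  refine Integrable.induction (μ := μ) (fun f : α → ℝ =>
    Tendsto (fun n => ∫ x in T^[n] ⁻¹' B, f x ∂μ) atTop (𝓝 ((∫ x, f x ∂μ) * μ.real B)))
    ?_ ?_ ?_ ?_ hf
  · intro c s hs _
    have h1 : ∀ n, ∫ x in T^[n] ⁻¹' B, s.indicator (fun _ => c) x ∂μ
        = μ.real (s ∩ T^[n] ⁻¹' B) * c := fun n => by
      rw [setIntegral_indicator hs, setIntegral_const, Set.inter_comm, smul_eq_mul]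
    simp only [h1, integral_indicator hs, setIntegral_const, smul_eq_mul]
    rw [mul_right_comm]
    exact (h s B hs hB).mul_const c
  · intro f g _ hf hg ihf ihg
    have h1 : ∀ n, ∫ x in T^[n] ⁻¹' B, (f + g) x ∂μ =
        (∫ x in T^[n] ⁻¹' B, f x ∂μ) + ∫ x in T^[n] ⁻¹' B, g x ∂μ :=
      fun n => integral_add hf.integrableOn hg.integrableOn
    have h2 : ∫ x, (f + g) x ∂μ = (∫ x, f x ∂μ) + ∫ x, g x ∂μ := integral_add hf hg
    simp only [h1, h2, add_mul]
    exact ihf.add ihg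
  · -- Both sides are Lipschitz in the `L¹` norm, uniformly in `n`.
    have hlip : ∀ (s : Set α) (f g : α →₁[μ] ℝ),
        |(∫ x in s, f x ∂μ) - ∫ x in s, g x ∂μ| ≤ dist f g := by
      intro s f g
      rw [← integral_sub (L1.integrable_coeFn f).restrict (L1.integrable_coeFn g).restrict,
        dist_eq_norm, L1.norm_eq_integral_norm]
      calc |∫ x in s, (f x - g x) ∂μ| ≤ ∫ x in s, ‖f x - g x‖ ∂μ :=
            abs_integral_le_integral_abs
        _ ≤ ∫ x, ‖f x - g x‖ ∂μ := setIntegral_le_integral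
            ((L1.integrable_coeFn f).sub (L1.integrable_coeFn g)).norm
            (Eventually.of_forall fun _ => norm_nonneg _)
        _ = ∫ x, ‖(f - g) x‖ ∂μ := integral_congr_ae <| by
            filter_upwards [Lp.coeFn_sub f g] with x hx
            rw [hx, Pi.sub_apply]
    refine isClosed_of_closure_subset fun f hf => ?_
    rw [Set.mem_ofPred_eq, Metric.tendsto_atTop]
    intro ε hε
    obtain ⟨g, hg, hfg⟩ := Metric.mem_closure_iff.1 hf (ε / 3) (by positivity)
    obtain ⟨N, hN⟩ := Metric.tendsto_atTop.1 hg (ε / 3) (by positivity)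
    refine ⟨N, fun n hn => ?_⟩
    have h1 := hlip (T^[n] ⁻¹' B) f g
    have h2 := hN n hn
    have h3 := hlip Set.univ f g
    simp only [setIntegral_univ] at h3
    have h4 : |(∫ x, f x ∂μ) * μ.real B - (∫ x, g x ∂μ) * μ.real B| ≤ dist f g := by
      rw [← sub_mul, abs_mul, abs_of_nonneg (measureReal_nonneg (μ := μ) (s := B))]
      exact (mul_le_of_le_one_right (abs_nonneg _) measureReal_le_one).trans h3
    rw [Real.dist_eq] at h2 ⊢
    rw [abs_le] at h1 h4
    rw [abs_lt] at h2 ⊢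
    constructor <;> linarith
  · intro f g hfg _ ih
    rw [← integral_congr_ae hfg]
    simpa only [fun n => integral_congr_ae (ae_restrict_of_ae (s := T^[n] ⁻¹' B) hfg)] using ih

/-- Under a mixing transformation, every absolutely continuous probability measure converges
setwise to the invariant one. -/
theorem IsMixing.tendsto_measureReal_preimage (h : IsMixing T μ) (hT : MeasurePreserving T μ μ)
    {ρ : Measure α} [IsProbabilityMeasure ρ] (hρ : ρ ≪ μ) {B : Set α} (hB : MeasurableSet B) :
    Tendsto (fun n => ρ.real (T^[n] ⁻¹' B)) atTop (𝓝 (μ.real B)) := by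
  have key := h.tendsto_setIntegral hT hB (Measure.integrable_toReal_rnDeriv (μ := ρ) (ν := μ))
  simpa only [Measure.setIntegral_toReal_rnDeriv hρ, Measure.integral_toReal_rnDeriv hρ,
    probReal_univ, one_mul] using key

end Mixing

/-! ### Product measures -/

section Product

variable {ι X : Type*} [MeasurableSpace X]

/-- A measurable event that depends only on the coordinates in `s` is generated by these
coordinates. -/
theorem measurableSet_cylinderEvents_of_dependsOn {A : Set (ι → X)} (hA : MeasurableSet A)
    {s : Set ι} (hs : DependsOn (fun f => f ∈ A) s) :
    MeasurableSet[MeasureTheory.cylinderEvents (X := fun _ => X) s] A := by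
  classical
  rcases isEmpty_or_nonempty (ι → X) with h | ⟨⟨z⟩⟩
  · rw [Set.eq_empty_of_isEmpty A]
    exact @MeasurableSet.empty _ (MeasureTheory.cylinderEvents s)
  -- Freezing the coordinates outside `s` does not change membership in `A`.
  have hm : @Measurable _ _ (MeasureTheory.cylinderEvents (X := fun _ => X) s) _
      (fun (f : ι → X) i => if i ∈ s then f i else z i) := by
    refine @measurable_pi_lambda _ _ _ (MeasureTheory.cylinderEvents (X := fun _ => X) s) _ _
      fun i => ?_
    by_cases hi : i ∈ s
    · simpa only [hi, if_true] using measurable_cylinderEvent_apply (X := fun _ => X) hi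
    · simpa only [hi, if_false] using measurable_const
  have hpre : (fun (f : ι → X) i => if i ∈ s then f i else z i) ⁻¹' A = A := by
    ext f
    exact iff_of_eq (hs fun i hi => if_pos hi)
  rw [← hpre]
  exact hm hA

/-- Under a product measure, events that depend on disjoint sets of coordinates are
independent. -/
theorem infinitePi_real_inter_of_dependsOn (μ : Measure X) [IsProbabilityMeasure μ]
    {A B : Set (ι → X)} (hA : MeasurableSet A) (hB : MeasurableSet B) {s t : Set ι}
    (hs : DependsOn (fun f => f ∈ A) s) (ht : DependsOn (fun f => f ∈ B) t) (hst : Disjoint s t) :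
    (Measure.infinitePi fun _ : ι => μ).real (A ∩ B) =
      (Measure.infinitePi fun _ : ι => μ).real A * (Measure.infinitePi fun _ : ι => μ).real B := by
  have hind : iIndepFun (fun i (f : ι → X) => f i) (Measure.infinitePi fun _ : ι => μ) :=
    iIndepFun_infinitePi (X := fun _ x => x) fun _ => measurable_id
  have h := indep_iSup_of_disjoint (fun i => (measurable_pi_apply i).comap_le) hind hst
  rw [measureReal_def, Indep_iff _ _ _ |>.1 h _ _ (measurableSet_cylinderEvents_of_dependsOn hA hs)
    (measurableSet_cylinderEvents_of_dependsOn hB ht), ENNReal.toReal_mul]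
  rfl

theorem measurePreserving_infinitePi_comp (μ : Measure X) [IsProbabilityMeasure μ] {e : ι → ι}
    (he : Function.Injective e) :
    MeasurePreserving (fun (f : ι → X) i => f (e i)) (Measure.infinitePi fun _ : ι => μ)
      (Measure.infinitePi fun _ : ι => μ) :=
  ⟨measurable_pi_lambda _ fun i => measurable_pi_apply (e i),
    Measure.map_infinitePi_infinitePi_of_inj (P := fun _ => μ) he⟩

theorem exists_finset_dependsOn_of_mem_measurableCylinders {A : Set (ι → X)}
    (hA : A ∈ measurableCylinders fun _ : ι => X) :
    ∃ s : Finset ι, DependsOn (fun f => f ∈ A) (s : Set ι) := by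
  obtain ⟨s, S, -, rfl⟩ := (mem_measurableCylinders A).1 hA
  refine ⟨s, fun f g hfg => ?_⟩
  simp only [mem_cylinder]
  congr 1
  exact funext fun i => hfg i i.2

end Product

/-! ### The stirring permutations -/

section Stirring

variable {S : Stirring} {x t : ℤ}

/-- Two adjacent edges cannot both stir: if both fire, they lie in the same run. -/
theorem Stirs.not_stirs_add_one (h : Stirs S x t) : ¬ Stirs S (x + 1) t := by
  intro h'
  have hfire : ∀ z ∈ Set.uIcc x (x + 1), (S (z, t)).1 = true := by
    intro z hz
    rw [Set.uIcc_of_le (by omega), Set.mem_Icc] at hz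
    rcases (by omega : z = x ∨ z = x + 1) with rfl | rfl
    exacts [h.1, h'.1]
  have h1 := h.2 (x + 1) (by omega) hfire
  have h2 := h'.2 x (by omega) (by rwa [Set.uIcc_comm])
  exact lt_asymm h1 h2

theorem Stirs.not_stirs_sub_one (h : Stirs S x t) : ¬ Stirs S (x - 1) t := fun h' => by
  have := h'.not_stirs_add_one
  rw [sub_add_cancel] at this
  exact this h

open Classical in
/-- The permutation of `ℤ` that is carried out between the times `t` and `t + 1`: it exchanges the
two end points of every stirring edge. -/
noncomputable def stir (S : Stirring) (t x : ℤ) : ℤ :=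
  if Stirs S x t then x + 1 else if Stirs S (x - 1) t then x - 1 else x

theorem stir_involutive (S : Stirring) (t : ℤ) : Function.Involutive (stir S t) := by
  intro x
  by_cases h1 : Stirs S x t
  · simp [stir, h1, h1.not_stirs_add_one]
  · by_cases h2 : Stirs S (x - 1) t
    · simp [stir, h1, h2]
    · simp [stir, h1, h2]

theorem position_succ (S : Stirring) (t₀ x : ℤ) (n : ℕ) :
    position S t₀ x (n + 1) = stir S (t₀ + n) (position S t₀ x n) := rfl

theorem position_injective (S : Stirring) (t₀ : ℤ) (n : ℕ) :
    Function.Injective fun x => position S t₀ x n := by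
  induction n with
  | zero => exact fun _ _ h => h
  | succ n ih => exact (stir_involutive S _).injective.comp ih

theorem position_surjective (S : Stirring) (t₀ : ℤ) (n : ℕ) :
    Function.Surjective fun x => position S t₀ x n := by
  induction n with
  | zero => exact fun x => ⟨x, rfl⟩
  | succ n ih => exact (stir_involutive S _).surjective.comp ih

/-- The initial location of the stirring particle which is at `x` at time `t₀ + n`. -/
noncomputable def origin (S : Stirring) (t₀ : ℤ) (n : ℕ) (x : ℤ) : ℤ :=
  (position_surjective S t₀ n x).choose

@[simp]
theorem position_origin (S : Stirring) (t₀ : ℤ) (n : ℕ) (x : ℤ) :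
    position S t₀ (origin S t₀ n x) n = x :=
  (position_surjective S t₀ n x).choose_spec

theorem origin_injective (S : Stirring) (t₀ : ℤ) (n : ℕ) : Function.Injective (origin S t₀ n) :=
  Function.LeftInverse.injective (g := fun y => position S t₀ y n) (position_origin S t₀ n)

theorem trajectory_eq_comp_origin (S : Stirring) (t₀ : ℤ) (η : Config) (n : ℕ) :
    trajectory S t₀ η n = fun x => η (origin S t₀ n x) := by
  funext x
  have h : (∃ y : ℤ, η y = true ∧ position S t₀ y n = x) ↔ η (origin S t₀ n x) = true := by
    constructor
    · rintro ⟨y, hy, rfl⟩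
      rwa [position_injective S t₀ n (position_origin S t₀ n (position S t₀ y n))]
    · exact fun h => ⟨_, h, position_origin S t₀ n x⟩
  simp [trajectory, h]

/-- The translation of the stirring variables by one unit of time. -/
def shiftStirring (S : Stirring) : Stirring := fun e => S (e.1, e.2 + 1)

theorem shiftStirring_iterate (S : Stirring) (n : ℕ) :
    shiftStirring^[n] S = fun e => S (e.1, e.2 + n) := by
  induction n with
  | zero => simp
  | succ n ih =>
    rw [Function.iterate_succ_apply', ih]
    funext e
    simp only [shiftStirring, Nat.cast_succ]
    congr 2
    ring

theorem position_shiftStirring (S : Stirring) (t₀ x : ℤ) (n : ℕ) :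
    position (shiftStirring S) t₀ x n = position S t₀ (stir S t₀ x) (n + 1) := by
  induction n with
  | zero =>
    rw [position_succ]
    simp only [position, Nat.cast_zero, add_zero]
    exact (stir_involutive S t₀ x).symm
  | succ n ih =>
    rw [position_succ, ih, position_succ (n := n + 1)]
    have : t₀ + ((n + 1 : ℕ) : ℤ) = t₀ + n + 1 := by push_cast; ring
    rw [this]
    rfl

theorem trajectory_shiftStirring (S : Stirring) (t₀ : ℤ) (η : Config) (n : ℕ) :
    trajectory (shiftStirring S) t₀ (trajectory S t₀ η 1) n = trajectory S t₀ η (n + 1) := by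
  have h : ∀ x, origin S t₀ 1 (origin (shiftStirring S) t₀ n x) = origin S t₀ (n + 1) x := by
    intro x
    apply position_injective S t₀ (n + 1)
    have h1 := position_shiftStirring S t₀ (origin (shiftStirring S) t₀ n x) n
    have h2 := position_origin S t₀ 1 (origin (shiftStirring S) t₀ n x)
    rw [position_succ] at h2
    simp only [position, Nat.cast_zero, add_zero] at h2
    rw [(stir_involutive S t₀).eq_iff] at h2
    simp only [position_origin] at h1 ⊢
    rw [h2]
    exact h1.symm
  simp only [trajectory_eq_comp_origin, h]

/-- One time step of the process as a transformation of the stirring variables together with the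
current configuration. The stirring variables are translated so that the next time level becomes
level `t₀`. -/
noncomputable def evolve (t₀ : ℤ) (ω : Stirring × Config) : Stirring × Config :=
  (shiftStirring ω.1, trajectory ω.1 t₀ ω.2 1)

theorem evolve_iterate (t₀ : ℤ) (n : ℕ) (ω : Stirring × Config) :
    (evolve t₀)^[n] ω = (shiftStirring^[n] ω.1, trajectory ω.1 t₀ ω.2 n) := by
  induction n generalizing ω with
  | zero => exact Prod.ext rfl (funext fun x => by simp [trajectory, position])
  | succ n ih =>
    rw [Function.iterate_succ_apply, ih, Function.iterate_succ_apply]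
    exact Prod.ext rfl (trajectory_shiftStirring ω.1 t₀ ω.2 n)

/-- The trajectory map intertwines `evolve` with the time shift. -/
theorem semiconj_trajectory (t₀ : ℤ) :
    Function.Semiconj (fun ω : Stirring × Config => trajectory ω.1 t₀ ω.2) (evolve t₀)
      timeShift :=
  fun ω => funext fun n => trajectory_shiftStirring ω.1 t₀ ω.2 n

end Stirring

/-! ### Invariance of the product measure -/

instance (q : unitInterval) : IsProbabilityMeasure (bernoulliProduct q) := by
  unfold bernoulliProduct; infer_instance

instance (p : unitInterval) : IsProbabilityMeasure (stirringLaw p) := by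
  unfold stirringLaw; infer_instance

theorem measurePreserving_trajectory_bernoulliProduct (q : unitInterval) (S : Stirring) (t₀ : ℤ)
    (n : ℕ) : MeasurePreserving (fun η => trajectory S t₀ η n) (bernoulliProduct q)
      (bernoulliProduct q) := by
  simp only [trajectory_eq_comp_origin]
  exact measurePreserving_infinitePi_comp _ (origin_injective S t₀ n)

theorem measurable_trajectory_swap (t₀ : ℤ) :
    Measurable fun ω : Stirring × Config => trajectory ω.1 t₀ ω.2 :=
  (measurable_trajectory t₀).comp measurable_swap

theorem measurePreserving_shiftStirring (p : unitInterval) :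
    MeasurePreserving shiftStirring (stirringLaw p) (stirringLaw p) := by
  refine measurePreserving_infinitePi_comp (e := fun e : ℤ × ℤ => (e.1, e.2 + 1)) _ ?_
  rintro ⟨a, b⟩ ⟨c, d⟩ h
  simpa using h

theorem measurePreserving_evolve (p q : unitInterval) (t₀ : ℤ) :
    MeasurePreserving (evolve t₀) ((stirringLaw p).prod (bernoulliProduct q))
      ((stirringLaw p).prod (bernoulliProduct q)) :=
  (measurePreserving_shiftStirring p).skew_product
    (g := fun S η => trajectory S t₀ η 1)
    ((measurable_pi_apply 1).comp (measurable_trajectory_swap t₀))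
    (ae_of_all _ fun S => (measurePreserving_trajectory_bernoulliProduct q S t₀ 1).map_eq)

theorem pathLaw_eq_map_prod_stirringLaw (p : unitInterval) (t₀ : ℤ) (ν : Measure Config)
    [SFinite ν] :
    pathLaw p t₀ ν = ((stirringLaw p).prod ν).map fun ω => trajectory ω.1 t₀ ω.2 := by
  rw [pathLaw, ← Measure.prod_swap, Measure.map_map (measurable_trajectory t₀) measurable_swap]
  rfl

theorem map_apply_pathLaw (p : unitInterval) (t₀ : ℤ) (ν : Measure Config) [SFinite ν] (n : ℕ) :
    (pathLaw p t₀ ν).map (fun η => η n) =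
      ((stirringLaw p).prod ν).map fun ω => trajectory ω.1 t₀ ω.2 n := by
  rw [pathLaw_eq_map_prod_stirringLaw, Measure.map_map (measurable_pi_apply n)
    (measurable_trajectory_swap t₀)]
  rfl

theorem isInvariant_bernoulliProduct (p q : unitInterval) (t₀ : ℤ) :
    IsInvariant p t₀ (bernoulliProduct q) := by
  intro n
  have h := (MeasurePreserving.id (stirringLaw p)).skew_product
    (g := fun S η => trajectory S t₀ η n)
    ((measurable_pi_apply n).comp (measurable_trajectory_swap t₀))
    (ae_of_all _ fun S => (measurePreserving_trajectory_bernoulliProduct q S t₀ n).map_eq)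
  rw [map_apply_pathLaw]
  exact (measurePreserving_snd.comp h).map_eq

/-! ### Edges stir with a common probability -/

theorem stirs_congr {S S' : Stirring} {t : ℤ} (h : ∀ z, S (z, t) = S' (z, t)) (x : ℤ) :
    Stirs S x t ↔ Stirs S' x t := by
  simp only [Stirs, h]

theorem stir_congr {S S' : Stirring} {t : ℤ} (h : ∀ z, S (z, t) = S' (z, t)) :
    stir S t = stir S' t := by
  funext x
  classical
  exact if_congr (stirs_congr h x) rfl (if_congr (stirs_congr h (x - 1)) rfl rfl)

theorem stirs_translate (S : Stirring) (x t : ℤ) :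
    Stirs (fun e => S (e.1 + x, e.2 + t)) 0 0 ↔ Stirs S x t := by
  simp only [Stirs, zero_add]
  refine and_congr_right fun _ => ⟨fun h y hy hf => ?_, fun h y hy hf => ?_⟩
  · have := h (y - x) (sub_ne_zero.2 hy) fun z hz => hf (z + x) <| by
      rw [Set.mem_uIcc] at hz ⊢; omega
    simpa using this
  · refine h (y + x) (by omega) fun z hz => ?_
    have := hf (z - x) <| by rw [Set.mem_uIcc] at hz ⊢; omega
    simpa using this

/-- The probability that a given edge stirs. -/
noncomputable def stirProb (p : unitInterval) : ℝ := (stirringLaw p).real {S | Stirs S 0 0}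

theorem stirringLaw_real_stirs (p : unitInterval) (x t : ℤ) :
    (stirringLaw p).real {S | Stirs S x t} = stirProb p := by
  have hinj : Function.Injective fun e : ℤ × ℤ => (e.1 + x, e.2 + t) := by
    rintro ⟨a, b⟩ ⟨c, d⟩ h
    simpa using h
  have h := (measurePreserving_infinitePi_comp
    ((bernoulliMeasure true false p).prod (volume : Measure unitInterval)) hinj).measureReal_preimage
    (measurableSet_stirs 0 0).nullMeasurableSet
  rw [stirProb, stirringLaw, ← h]
  congr 1
  ext S
  exact (stirs_translate S x t).symm

theorem stirringLaw_real_fires (p : unitInterval) (e : ℤ × ℤ) (b : Bool) :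
    (stirringLaw p).real {S | (S e).1 = b} = if b then (p : ℝ) else 1 - p := by
  have h := (measurePreserving_fst (μ := bernoulliMeasure true false p)
    (ν := (volume : Measure unitInterval))).comp (measurePreserving_eval_infinitePi
      (fun _ : ℤ × ℤ => (bernoulliMeasure true false p).prod (volume : Measure unitInterval)) e)
  have h2 := h.measureReal_preimage (measurableSet_singleton b).nullMeasurableSet
  rw [bernoulliMeasure_real_apply p (measurableSet_singleton b)] at h2
  refine h2.trans ?_
  cases b <;> simp

theorem stirProb_le (p : unitInterval) : stirProb p ≤ p := by
  rw [← (stirringLaw_real_fires p (0, 0) true).trans (if_pos rfl)]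
  exact measureReal_mono fun S hS => hS.1

/-- An edge stirs if it fires and neither of its neighbours does. -/
theorem stirProb_pos {p : unitInterval} (h0 : 0 < (p : ℝ)) (h1 : (p : ℝ) < 1) :
    0 < stirProb p := by
  let A : ℤ → Bool → Set Stirring := fun x b => {S | (S (x, 0)).1 = b}
  have hm : ∀ x b, MeasurableSet (A x b) := fun x b =>
    (measurable_fst.comp (measurable_pi_apply (x, (0 : ℤ)))) (measurableSet_singleton b)
  have hd : ∀ x b, DependsOn (fun S => S ∈ A x b) {((x, 0) : ℤ × ℤ)} := fun x b S S' h => by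
    simp only [A, Set.mem_ofPred_eq, h (x, 0) rfl]
  have hd2 : DependsOn (fun S => S ∈ A 1 false ∩ A (-1) false)
      {((1, 0) : ℤ × ℤ), ((-1, 0) : ℤ × ℤ)} := fun S S' h => by
    simp only [A, Set.mem_inter_iff, Set.mem_ofPred_eq, h (1, 0) (by simp),
      h (-1, 0) (by simp)]
  have hval : (stirringLaw p).real (A 0 true ∩ (A 1 false ∩ A (-1) false)) =
      p * ((1 - p) * (1 - p)) := by
    rw [stirringLaw, infinitePi_real_inter_of_dependsOn _ (hm 0 true)
      ((hm 1 false).inter (hm (-1) false)) (hd 0 true) hd2 (by simp),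
      infinitePi_real_inter_of_dependsOn _ (hm 1 false) (hm (-1) false) (hd 1 false)
        (hd (-1) false) (by simp), ← stirringLaw]
    simp only [A, stirringLaw_real_fires]
    simp
  have h1' : 0 < 1 - (p : ℝ) := sub_pos.2 h1
  refine lt_of_lt_of_le (by positivity : (0 : ℝ) < p * ((1 - p) * (1 - p))) ?_
  rw [← hval]
  refine measureReal_mono ?_
  rintro S ⟨hS0, hS1, hS2⟩
  refine ⟨hS0, fun y hy hf => ?_⟩
  exfalso
  rcases lt_or_gt_of_ne hy with h | h
  · have := hf (-1) (by rw [Set.mem_uIcc]; omega)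
    exact Bool.false_ne_true (hS2.symm.trans this)
  · have := hf 1 (by rw [Set.mem_uIcc]; omega)
    exact Bool.false_ne_true (hS1.symm.trans this)

/-! ### A single particle performs a lazy simple random walk -/

theorem dependsOn_position (t₀ x : ℤ) (n : ℕ) :
    DependsOn (fun S : Stirring => position S t₀ x n) {e : ℤ × ℤ | e.2 < t₀ + n} := by
  induction n with
  | zero => exact fun _ _ _ => rfl
  | succ n ih =>
    intro S S' h
    have h1 : position S t₀ x n = position S' t₀ x n :=
      ih fun e he => h e (by simp only [Set.mem_ofPred_eq] at he ⊢; push_cast; omega)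
    have h2 : ∀ z, S (z, t₀ + n) = S' (z, t₀ + n) := fun z => h _ (by simp)
    exact (congrArg (stir S _) h1).trans (congrFun (stir_congr h2) _)

/-- The master equation of the position of a single particle. -/
theorem stirringLaw_real_position_succ (p : unitInterval) (t₀ y x : ℤ) (n : ℕ) :
    (stirringLaw p).real {S | position S t₀ y (n + 1) = x} =
      (1 - 2 * stirProb p) * (stirringLaw p).real {S | position S t₀ y n = x} +
      stirProb p * ((stirringLaw p).real {S | position S t₀ y n = x - 1} +
        (stirringLaw p).real {S | position S t₀ y n = x + 1}) := by
  set t := t₀ + (n : ℤ) with ht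
  let Q : ℤ → Set Stirring := fun z => {S | position S t₀ y n = z}
  let E : ℤ → Set Stirring := fun z => {S | Stirs S z t}
  have hQ : ∀ z, MeasurableSet (Q z) := fun z =>
    measurable_position t₀ y n (measurableSet_singleton z)
  have hE : ∀ z, MeasurableSet (E z) := fun z => measurableSet_stirs z t
  have hdisj : Disjoint (E x) (E (x - 1)) :=
    Set.disjoint_left.2 fun S h h' => Stirs.not_stirs_sub_one h h'
  -- The position at time `t` and the stirring edges at time `t` are independent.
  have hind : ∀ z (G : Set Stirring), MeasurableSet G →
      DependsOn (fun S => S ∈ G) {e : ℤ × ℤ | e.2 = t} →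
      (stirringLaw p).real (Q z ∩ G) = (stirringLaw p).real (Q z) * (stirringLaw p).real G := by
    intro z G hG hGd
    refine infinitePi_real_inter_of_dependsOn _ (hQ z) hG (s := {e : ℤ × ℤ | e.2 < t}) ?_ hGd ?_
    · intro S S' h
      simp only [Q, Set.mem_ofPred_eq, dependsOn_position t₀ y n h]
    · exact Set.disjoint_left.2 fun e h h' => h.ne h'
  have hEd : ∀ z, DependsOn (fun S => S ∈ E z) {e : ℤ × ℤ | e.2 = t} := fun z S S' h =>
    propext (stirs_congr (fun w => h (w, t) rfl) z)
  have hNd : DependsOn (fun S => S ∈ (E x ∪ E (x - 1))ᶜ) {e : ℤ × ℤ | e.2 = t} := by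
    intro S S' h
    have h1 := hEd x h
    have h2 := hEd (x - 1) h
    simp only at h1 h2
    simp only [Set.mem_compl_iff, Set.mem_union, h1, h2]
  have hN : (stirringLaw p).real (E x ∪ E (x - 1))ᶜ = 1 - 2 * stirProb p := by
    rw [probReal_compl_eq_one_sub ((hE x).union (hE _)), measureReal_union hdisj (hE _)]
    simp only [E, stirringLaw_real_stirs]
    ring
  have hset : {S | position S t₀ y (n + 1) = x} =
      (Q x ∩ (E x ∪ E (x - 1))ᶜ) ∪ ((Q (x - 1) ∩ E (x - 1)) ∪ (Q (x + 1) ∩ E x)) := by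
    ext S
    simp only [Set.mem_ofPred_eq, position_succ, (stir_involutive S _).eq_iff, Set.mem_union,
      Set.mem_inter_iff, Set.mem_compl_iff, Q, E, ← ht]
    by_cases h1 : Stirs S x t
    · simp [stir, h1, h1.not_stirs_sub_one, eq_comm]
    · by_cases h2 : Stirs S (x - 1) t <;> simp [stir, h1, h2, eq_comm]
  have hd1 : Disjoint (Q (x - 1) ∩ E (x - 1)) (Q (x + 1) ∩ E x) :=
    (hdisj.symm).mono Set.inter_subset_right Set.inter_subset_right
  have hd2 : Disjoint (Q x ∩ (E x ∪ E (x - 1))ᶜ)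
      ((Q (x - 1) ∩ E (x - 1)) ∪ (Q (x + 1) ∩ E x)) := by
    refine Set.disjoint_left.2 fun S h h' => h.2 ?_
    exact h'.elim (fun h => Or.inr h.2) (fun h => Or.inl h.2)
  rw [hset, measureReal_union hd2 (((hQ _).inter (hE _)).union ((hQ _).inter (hE _))),
    measureReal_union hd1 ((hQ _).inter (hE _)), hind _ _ ((hE x).union (hE _)).compl hNd,
    hind _ _ (hE _) (hEd _), hind _ _ (hE _) (hEd _), hN]
  simp only [E, stirringLaw_real_stirs, Q]
  ring

/-- The Fourier representation of the transition probabilities of the lazy simple random walk with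
jump probability `r` in each direction. -/
noncomputable def walkKernel (r : ℝ) (n : ℕ) (k : ℤ) : ℝ :=
  (2 * Real.pi)⁻¹ * ∫ θ in (0 : ℝ)..2 * Real.pi,
    (1 - 2 * r + 2 * r * Real.cos θ) ^ n * Real.cos (k * θ)

theorem walkKernel_zero (r : ℝ) (k : ℤ) : walkKernel r 0 k = if k = 0 then 1 else 0 := by
  have hpi := Real.pi_ne_zero
  simp only [walkKernel, pow_zero, one_mul]
  split_ifs with h
  · simp [h]
    field_simp
  · have hk : (k : ℝ) ≠ 0 := Int.cast_ne_zero.2 h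
    have hsin : Real.sin (k * (2 * Real.pi)) = 0 := by
      have := Real.sin_int_mul_pi (k * 2)
      rw [← this]; push_cast; ring_nf
    rw [intervalIntegral.integral_comp_mul_left (fun θ => Real.cos θ) hk]
    simp [hsin]

theorem walkKernel_succ (r : ℝ) (n : ℕ) (k : ℤ) :
    walkKernel r (n + 1) k = (1 - 2 * r) * walkKernel r n k +
      r * (walkKernel r n (k - 1) + walkKernel r n (k + 1)) := by
  have hint : ∀ k : ℤ, IntervalIntegrable (fun θ : ℝ =>
      (1 - 2 * r + 2 * r * Real.cos θ) ^ n * Real.cos (k * θ)) volume 0 (2 * Real.pi) := fun k =>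
    Continuous.intervalIntegrable (by fun_prop) _ _
  have h : ∀ θ : ℝ, (1 - 2 * r + 2 * r * Real.cos θ) ^ (n + 1) * Real.cos (k * θ) =
      (1 - 2 * r) * ((1 - 2 * r + 2 * r * Real.cos θ) ^ n * Real.cos (k * θ)) +
      r * ((1 - 2 * r + 2 * r * Real.cos θ) ^ n * Real.cos ((k - 1 : ℤ) * θ) +
        (1 - 2 * r + 2 * r * Real.cos θ) ^ n * Real.cos ((k + 1 : ℤ) * θ)) := by
    intro θ
    have h1 : ((k - 1 : ℤ) : ℝ) * θ = k * θ - θ := by push_cast; ring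
    have h2 : ((k + 1 : ℤ) : ℝ) * θ = k * θ + θ := by push_cast; ring
    rw [h1, h2, Real.cos_sub, Real.cos_add]
    ring
  simp only [walkKernel, h]
  rw [intervalIntegral.integral_add ((hint k).const_mul _)
    (((hint (k - 1)).add (hint (k + 1))).const_mul _), intervalIntegral.integral_const_mul,
    intervalIntegral.integral_const_mul, intervalIntegral.integral_add (hint _) (hint _)]
  ring

theorem tendsto_walkKernel {r : ℝ} (h0 : 0 < r) (h1 : r < 1 / 2) (k : ℤ) :
    Tendsto (fun n => walkKernel r n k) atTop (𝓝 0) := by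
  have hb : ∀ θ, |1 - 2 * r + 2 * r * Real.cos θ| ≤ 1 := fun θ => by
    have h2 := Real.cos_le_one θ
    have h3 := Real.neg_one_le_cos θ
    rw [abs_le]
    constructor <;> nlinarith
  have key : Tendsto (fun n : ℕ => ∫ θ in (0 : ℝ)..2 * Real.pi,
      (1 - 2 * r + 2 * r * Real.cos θ) ^ n * Real.cos (k * θ)) atTop
      (𝓝 (∫ _ in (0 : ℝ)..2 * Real.pi, (0 : ℝ))) := by
    refine intervalIntegral.tendsto_integral_filter_of_dominated_convergence (fun _ => 1)
      (Eventually.of_forall fun n => Continuous.aestronglyMeasurable (by fun_prop))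
      (Eventually.of_forall fun n => ae_of_all _ fun θ _ => ?_) (by simp) ?_
    · rw [norm_mul, norm_pow]
      exact mul_le_one₀ (pow_le_one₀ (norm_nonneg _) (hb θ)) (norm_nonneg _)
        (Real.abs_cos_le_one _)
    · -- The base has modulus less than one on `(0, 2π)`; the end point `2π` is negligible.
      have hne : ∀ᵐ θ : ℝ, θ ≠ 2 * Real.pi := by simp [ae_iff]
      filter_upwards [hne] with θ hθ hmem
      rw [Set.uIoc_of_le Real.two_pi_pos.le] at hmem
      have hlt : θ < 2 * Real.pi := lt_of_le_of_ne hmem.2 hθ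
      have hcos : Real.cos θ < 1 := by
        refine lt_of_le_of_ne (Real.cos_le_one θ) fun h => ?_
        have := (Real.cos_eq_one_iff_of_lt_of_lt (by linarith [hmem.1, Real.pi_pos]) hlt).1 h
        exact hmem.1.ne' this
      have h3 := Real.neg_one_le_cos θ
      have habs : |1 - 2 * r + 2 * r * Real.cos θ| < 1 := by
        rw [abs_lt]
        constructor <;> nlinarith
      have := (tendsto_pow_atTop_nhds_zero_of_abs_lt_one habs).mul_const (Real.cos (k * θ))
      simpa using this
  simpa [walkKernel] using key.const_mul (2 * Real.pi)⁻¹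

theorem stirringLaw_real_position (p : unitInterval) (t₀ y x : ℤ) (n : ℕ) :
    (stirringLaw p).real {S | position S t₀ y n = x} = walkKernel (stirProb p) n (x - y) := by
  induction n generalizing x with
  | zero =>
    rw [walkKernel_zero]
    by_cases h : x = y
    · simp [position, h]
    · simp [position, sub_eq_zero, h, Ne.symm h]
  | succ n ih =>
    rw [stirringLaw_real_position_succ, walkKernel_succ, ih, ih, ih]
    congr 4 <;> ring

/-- A stirring particle escapes from every site. -/
theorem tendsto_stirringLaw_real_position {p : unitInterval} (h0 : 0 < (p : ℝ))
    (hp : (p : ℝ) < 1 / 2) (t₀ y x : ℤ) :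
    Tendsto (fun n => (stirringLaw p).real {S | position S t₀ y n = x}) atTop (𝓝 0) := by
  simp only [stirringLaw_real_position]
  exact tendsto_walkKernel (stirProb_pos h0 (by linarith)) ((stirProb_le p).trans_lt hp) _

/-! ### Mixing -/

theorem measurable_evolve (t₀ : ℤ) : Measurable (evolve t₀) := by
  refine Measurable.prodMk (measurable_pi_lambda _ fun e => ?_)
    ((measurable_pi_apply 1).comp (measurable_trajectory_swap t₀))
  exact (measurable_pi_apply (e.1, e.2 + 1)).comp measurable_fst

/-- If no stirring particle that starts in `F` is in `G` at time `t₀ + n`, the initial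
configuration on `F` is independent of the configuration on `G` at time `t₀ + n`. -/
theorem bernoulliProduct_real_inter_trajectory (q : unitInterval) {S : Stirring} {t₀ : ℤ} {n : ℕ}
    {A B : Set Config} (hA : MeasurableSet A) (hB : MeasurableSet B) {F G : Set ℤ}
    (hF : DependsOn (fun η => η ∈ A) F) (hG : DependsOn (fun η => η ∈ B) G)
    (hS : ∀ y ∈ F, position S t₀ y n ∉ G) :
    (bernoulliProduct q).real (A ∩ (fun η => trajectory S t₀ η n) ⁻¹' B) =
      (bernoulliProduct q).real A * (bernoulliProduct q).real B := by
  have hT := measurePreserving_trajectory_bernoulliProduct q S t₀ n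
  rw [← hT.measureReal_preimage hB.nullMeasurableSet]
  refine infinitePi_real_inter_of_dependsOn _ hA (hT.measurable hB) hF
    (t := origin S t₀ n '' G) (fun η η' h => hG fun x hx => ?_) ?_
  · simp only [trajectory_eq_comp_origin]
    exact h _ ⟨x, hx, rfl⟩
  · refine Set.disjoint_left.2 fun y hy ⟨x, hx, hxy⟩ => hS y hy ?_
    rwa [← hxy, position_origin]

/-- Rectangles of cylinder events, which generate the σ-algebra of `Stirring × Config`. -/
def cylinderRectangles : Set (Set (Stirring × Config)) :=
  Set.image2 (· ×ˢ ·) (measurableCylinders fun _ : ℤ × ℤ => Bool × unitInterval)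
    (measurableCylinders fun _ : ℤ => Bool)

theorem generateFrom_cylinderRectangles :
    (inferInstance : MeasurableSpace (Stirring × Config)) =
      MeasurableSpace.generateFrom cylinderRectangles :=
  (generateFrom_eq_prod generateFrom_measurableCylinders generateFrom_measurableCylinders
    ⟨fun _ => Set.univ, fun _ => univ_mem_measurableCylinders _, Set.iUnion_const _⟩
    ⟨fun _ => Set.univ, fun _ => univ_mem_measurableCylinders _, Set.iUnion_const _⟩).symm

theorem isPiSystem_cylinderRectangles : IsPiSystem cylinderRectangles :=
  isPiSystem_measurableCylinders.prod isPiSystem_measurableCylinders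

/-- The stirring variables in two finite space-time windows are independent once one of the windows
has been translated far enough in time. -/
theorem stirringLaw_real_inter_shiftStirring (p : unitInterval) {A B : Set Stirring}
    (hA : MeasurableSet A) (hB : MeasurableSet B) {I J : Finset (ℤ × ℤ)}
    (hI : DependsOn (fun S => S ∈ A) (I : Set (ℤ × ℤ)))
    (hJ : DependsOn (fun S => S ∈ B) (J : Set (ℤ × ℤ))) :
    ∀ᶠ n in atTop, (stirringLaw p).real (A ∩ shiftStirring^[n] ⁻¹' B) =
      (stirringLaw p).real A * (stirringLaw p).real B := by
  obtain ⟨a, ha⟩ : ∃ a : ℤ, ∀ e ∈ I, e.2 ≤ a := by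
    obtain ⟨a, ha⟩ := (I.image Prod.snd).bddAbove
    exact ⟨a, fun e he => ha (by simpa using ⟨e.1, he⟩)⟩
  obtain ⟨b, hb⟩ : ∃ b : ℤ, ∀ e ∈ J, b ≤ e.2 := by
    obtain ⟨b, hb⟩ := (J.image Prod.snd).bddBelow
    exact ⟨b, fun e he => hb (by simpa using ⟨e.1, he⟩)⟩
  filter_upwards [eventually_gt_atTop (a - b).toNat] with n hn
  have hT := (measurePreserving_shiftStirring p).iterate n
  rw [← hT.measureReal_preimage hB.nullMeasurableSet]
  refine infinitePi_real_inter_of_dependsOn _ hA (hT.measurable hB) hI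
    (t := (fun e : ℤ × ℤ => (e.1, e.2 + (n : ℤ))) '' J) (fun S S' h => hJ fun e he => ?_) ?_
  · simp only [shiftStirring_iterate]
    exact h _ ⟨e, he, rfl⟩
  · refine Set.disjoint_left.2 ?_
    rintro _ he ⟨e, he', rfl⟩
    have h1 := ha _ he
    have h2 := hb _ he'
    simp only at h1
    omega

theorem isMixing_evolve {p : unitInterval} (h0 : 0 < (p : ℝ)) (hp : (p : ℝ) < 1 / 2)
    (q : unitInterval) (t₀ : ℤ) :
    IsMixing (evolve t₀) ((stirringLaw p).prod (bernoulliProduct q)) := by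
  refine isMixing_of_isPiSystem (measurePreserving_evolve p q t₀) generateFrom_cylinderRectangles
    isPiSystem_cylinderRectangles ?_
  rintro _ ⟨A, hA, A', hA', rfl⟩ _ ⟨B, hB, B', hB', rfl⟩
  obtain ⟨I, hI⟩ := exists_finset_dependsOn_of_mem_measurableCylinders hA
  obtain ⟨J, hJ⟩ := exists_finset_dependsOn_of_mem_measurableCylinders hB
  obtain ⟨F, hF⟩ := exists_finset_dependsOn_of_mem_measurableCylinders hA'
  obtain ⟨G, hG⟩ := exists_finset_dependsOn_of_mem_measurableCylinders hB'
  replace hA := MeasurableSet.of_mem_measurableCylinders hA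
  replace hB := MeasurableSet.of_mem_measurableCylinders hB
  replace hA' := MeasurableSet.of_mem_measurableCylinders hA'
  replace hB' := MeasurableSet.of_mem_measurableCylinders hB'
  set P := stirringLaw p
  set ν := bernoulliProduct q
  -- The event that some particle which starts in `F` is in `G` after `n` steps is negligible.
  let D : ℕ → Set Stirring := fun n => ⋃ y ∈ F, ⋃ x ∈ G, {S | position S t₀ y n = x}
  have hDm : ∀ n, MeasurableSet (D n) := fun n =>
    F.measurableSet_biUnion fun y _ => G.measurableSet_biUnion fun x _ =>
      measurable_position t₀ y n (measurableSet_singleton x)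
  have hD : Tendsto (fun n => P.real (D n)) atTop (𝓝 0) := by
    have h : Tendsto (fun n => ∑ y ∈ F, ∑ x ∈ G, P.real {S | position S t₀ y n = x}) atTop
        (𝓝 (∑ y ∈ F, ∑ x ∈ G, 0)) :=
      tendsto_finsetSum _ fun y _ => tendsto_finsetSum _ fun x _ =>
        tendsto_stirringLaw_real_position h0 hp t₀ y x
    simp only [Finset.sum_const_zero] at h
    refine squeeze_zero (fun _ => measureReal_nonneg) (fun n => ?_) h
    exact (measureReal_biUnion_finset_le _ _).trans
      (Finset.sum_le_sum fun y _ => measureReal_biUnion_finset_le _ _)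
  -- Outside that event, the configurations at the two times are independent.
  let R : ℕ → Set Stirring := fun n => A ∩ shiftStirring^[n] ⁻¹' B
  have hRm : ∀ n, MeasurableSet (R n) := fun n =>
    hA.inter (((measurePreserving_shiftStirring p).iterate n).measurable hB)
  let E : ℕ → Set (Stirring × Config) := fun n =>
    (A ×ˢ A') ∩ (evolve t₀)^[n] ⁻¹' (B ×ˢ B')
  have hEm : ∀ n, MeasurableSet (E n) := fun n =>
    (hA.prod hA').inter (((measurable_evolve t₀).iterate n) (hB.prod hB'))
  have hmain : ∀ n, (P.prod ν).real (E n \ (D n ×ˢ Set.univ)) =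
      P.real (R n \ D n) * (ν.real A' * ν.real B') := by
    intro n
    have hfib : ∀ S, ν (Prod.mk S ⁻¹' (E n \ (D n ×ˢ Set.univ))) =
        (R n \ D n).indicator (fun _ => ν A' * ν B') S := by
      intro S
      by_cases hS : S ∈ R n \ D n
      · have hcol : ∀ y ∈ (F : Set ℤ), position S t₀ y n ∉ (G : Set ℤ) := fun y hy hG =>
          hS.2 (Set.mem_biUnion hy (Set.mem_biUnion hG rfl))
        have h1 := bernoulliProduct_real_inter_trajectory q hA' hB' hF hG hcol
        rw [Set.indicator_of_mem hS]
        have h2 : Prod.mk S ⁻¹' (E n \ (D n ×ˢ Set.univ)) =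
            A' ∩ (fun η => trajectory S t₀ η n) ⁻¹' B' := by
          ext η
          have h3 : S ∈ A := hS.1.1
          have h4 : shiftStirring^[n] S ∈ B := hS.1.2
          simp [E, evolve_iterate, h3, h4, hS.2]
        rw [h2, ← ENNReal.toReal_eq_toReal_iff' (measure_ne_top _ _)
          (ENNReal.mul_ne_top (measure_ne_top _ _) (measure_ne_top _ _)), ENNReal.toReal_mul]
        exact h1
      · rw [Set.indicator_of_notMem hS]
        have h2 : Prod.mk S ⁻¹' (E n \ (D n ×ˢ Set.univ)) = ∅ := by
          ext η
          simp only [Set.mem_preimage, Set.mem_empty_iff_false, iff_false]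
          rintro ⟨⟨h3, h4⟩, h5⟩
          rw [Set.mem_preimage, evolve_iterate] at h4
          exact hS ⟨⟨h3.1, h4.1⟩, fun h => h5 ⟨h, Set.mem_univ _⟩⟩
        rw [h2, measure_empty]
    rw [measureReal_def, Measure.prod_apply ((hEm n).diff ((hDm n).prod MeasurableSet.univ))]
    simp only [hfib]
    rw [lintegral_indicator ((hRm n).diff (hDm n)), setLIntegral_const, ENNReal.toReal_mul,
      ENNReal.toReal_mul, mul_comm]
    rfl
  -- Removing that event changes both sides by at most its probability.
  have hE : ∀ n, ‖(P.prod ν).real (E n) - (P.prod ν).real (E n \ (D n ×ˢ Set.univ))‖ ≤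
      P.real (D n) := by
    intro n
    have h1 := measureReal_sdiff_add_inter (μ := P.prod ν) (s := E n)
      ((hDm n).prod (MeasurableSet.univ (α := Config)))
    have h2 : (P.prod ν).real (E n ∩ D n ×ˢ Set.univ) ≤ P.real (D n) :=
      (measureReal_mono Set.inter_subset_right).trans_eq (by simp [measureReal_prod_prod])
    rw [← h1, add_sub_cancel_left, Real.norm_of_nonneg measureReal_nonneg]
    exact h2
  have hR : ∀ n, ‖P.real (R n) - P.real (R n \ D n)‖ ≤ P.real (D n) := by
    intro n
    rw [← measureReal_sdiff_add_inter (μ := P) (s := R n) (hDm n), add_sub_cancel_left,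
      Real.norm_of_nonneg measureReal_nonneg]
    exact measureReal_mono Set.inter_subset_right (measure_ne_top _ _)
  have hR' : Tendsto (fun n => P.real (R n \ D n)) atTop (𝓝 (P.real A * P.real B)) := by
    have h1 : Tendsto (fun n => P.real (R n)) atTop (𝓝 (P.real A * P.real B)) :=
      tendsto_const_nhds.congr' <|
        (stirringLaw_real_inter_shiftStirring p hA hB hI hJ).mono fun n h => h.symm
    have h2 := squeeze_zero_norm hR hD
    simpa using h1.sub h2
  have hlim := (squeeze_zero_norm hE hD).add (hR'.mul_const (ν.real A' * ν.real B'))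
  simp only [hmain, sub_add_cancel, zero_add] at hlim
  simp only [measureReal_prod_prod]
  rw [mul_mul_mul_comm]
  exact hlim

/-! ### Extremality and ergodicity -/

theorem ergodic_timeShift_pathLaw {p : unitInterval} (h0 : 0 < (p : ℝ)) (hp : (p : ℝ) < 1 / 2)
    (q : unitInterval) (t₀ : ℤ) :
    Ergodic timeShift (pathLaw p t₀ (bernoulliProduct q)) := by
  rw [pathLaw_eq_map_prod_stirringLaw]
  exact (measurable_trajectory_swap t₀).measurePreserving _ |>.ergodic_of_ergodic_semiconj
    ((isMixing_evolve h0 hp q t₀).ergodic (measurePreserving_evolve p q t₀))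
    (measurable_pi_lambda _ fun n => measurable_pi_apply (n + 1)) (semiconj_trajectory t₀)

/-- An invariant probability measure which is absolutely continuous with respect to the product
measure equals it: by mixing, the law at time `t₀ + n` converges to the product measure. -/
theorem IsInvariant.eq_bernoulliProduct {p : unitInterval} (h0 : 0 < (p : ℝ))
    (hp : (p : ℝ) < 1 / 2) {q : unitInterval} {t₀ : ℤ} {ν : Measure Config}
    [IsProbabilityMeasure ν] (hν : IsInvariant p t₀ ν) (hac : ν ≪ bernoulliProduct q) :
    ν = bernoulliProduct q := by
  refine Measure.ext fun B hB => ?_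
  rw [← ENNReal.toReal_eq_toReal_iff' (measure_ne_top _ _) (measure_ne_top _ _)]
  have hlim := (isMixing_evolve h0 hp q t₀).tendsto_measureReal_preimage
    (measurePreserving_evolve p q t₀)
    (Measure.AbsolutelyContinuous.rfl.prod hac : (stirringLaw p).prod ν ≪ _)
    (MeasurableSet.univ.prod hB : MeasurableSet ((Set.univ : Set Stirring) ×ˢ B))
  have hn : ∀ n, ((stirringLaw p).prod ν).real ((evolve t₀)^[n] ⁻¹' (Set.univ ×ˢ B)) =
      ν.real B := by
    intro n
    have hm : Measurable fun ω : Stirring × Config => trajectory ω.1 t₀ ω.2 n :=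
      (measurable_pi_apply n).comp (measurable_trajectory_swap t₀)
    conv_rhs => rw [← hν n, map_apply_pathLaw, map_measureReal_apply hm hB]
    congr 1
    ext ω
    simp [evolve_iterate]
  simp only [hn, measureReal_prod_prod, probReal_univ, one_mul] at hlim
  exact tendsto_nhds_unique tendsto_const_nhds hlim

end SSEP

theorem mainTheorem4 (p : unitInterval) (hp0 : 0 < (p : ℝ)) (hp : (p : ℝ) < 1 / 2)
    (q : unitInterval) (t₀ : ℤ) :
    SSEP.IsInvariant p t₀ (SSEP.bernoulliProduct q) ∧
    SSEP.bernoulliProduct q ∈ Set.extremePoints ENNReal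
      {ν : MeasureTheory.Measure SSEP.Config |
        MeasureTheory.IsProbabilityMeasure ν ∧ SSEP.IsInvariant p t₀ ν} ∧
    Ergodic SSEP.timeShift (SSEP.pathLaw p t₀ (SSEP.bernoulliProduct q)) := by
  refine ⟨SSEP.isInvariant_bernoulliProduct p q t₀,
    ⟨⟨inferInstance, SSEP.isInvariant_bernoulliProduct p q t₀⟩, ?_⟩,
    SSEP.ergodic_timeShift_pathLaw hp0 hp q t₀⟩
  -- A component of a convex combination with positive weight is absolutely continuous.
  rintro ν₁ ⟨hν₁, hinv⟩ ν₂ - ⟨a, b, ha, -, -, hab⟩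
  refine hinv.eq_bernoulliProduct hp0 hp (Measure.AbsolutelyContinuous.mk fun s _ hs => ?_)
  rw [← hab, Measure.add_apply, Measure.smul_apply, smul_eq_mul] at hs
  exact (mul_eq_zero.1 (add_eq_zero.1 hs).1).resolve_left ha.ne'
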